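/- Let $P$ be a finite set of primes. Then there are infinitely many Borel probability measures $\mu$ on $[0,1)$ that are $p$-adic doubling for every $p\in P$ but not doubling. Here: - $\mu$ is $p$-adic doubling if there is a constant $C>0$ such that for every $p$-adic interval $I=\left[\frac{k-1}{p^m},\frac{k}{p^m}\right)\subseteq[0,1)$, $m,k\in\mathbb Z$, its children $I_j=\left[\frac{k-1}{p^m}+\frac{j-1}{p^{m+1}},\frac{k-1}{p^m}+\frac{j}{p^{m+1}}\right)$, $1\le j\le p$, satisfy $\frac1C\le\frac{\mu(I_{j_1})}{\mu(I_{j_2})}\le C$ for all $1\le j_1,j_2\le p$ (in particular all the $\mu(I_j)$ are positive); - $\mu$ is doubling if there is a constant $C>0$ such that $\mu(2I)\le C\mu(I)$ for every bounded half-open interval $I=[c-r,c+r)$, $r>0$, with $2I\subseteq[0,1)$, where $2I=[c-2r,c+2r)$ is the interval with the same midpoint and twice the length. -/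

import Mathlib

open MeasureTheory Set
open scoped NNReal ENNReal

/-- The `n`-adic interval `[(k-1)/n^m, k/n^m)`, for integers `m` and `k` (and `n ≥ 1`). -/
def adicInterval (n : ℕ) (m k : ℤ) : Set ℝ :=
  Ico (((k : ℝ) - 1) / (n : ℝ) ^ m) ((k : ℝ) / (n : ℝ) ^ m)

/-- The `j`-th `n`-adic child, `1 ≤ j ≤ n`, of the `n`-adic interval `[(k-1)/n^m, k/n^m)`. -/
def adicChild (n : ℕ) (m k : ℤ) (j : ℕ) : Set ℝ :=
  Ico (((k : ℝ) - 1) / (n : ℝ) ^ m + ((j : ℝ) - 1) / (n : ℝ) ^ (m + 1))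
    (((k : ℝ) - 1) / (n : ℝ) ^ m + (j : ℝ) / (n : ℝ) ^ (m + 1))

/-- `μ` is `n`-adic doubling on `S`: the ratios of the measures of any two `n`-adic children of
an `n`-adic interval contained in `S` lie between `1/C` and `C`, with one constant `C` for all
these intervals. In `ℝ≥0∞` one has `0 / 0 = 0` and `x / ∞ = 0`, so the lower bound also says that
all these children have positive, finite measure. -/
def IsAdicDoublingOn (S : Set ℝ) (n : ℕ) (μ : Measure ℝ) : Prop :=
  ∃ C : ℝ≥0, 0 < C ∧ ∀ m k : ℤ, adicInterval n m k ⊆ S →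
    ∀ j₁ ∈ Finset.Icc 1 n, ∀ j₂ ∈ Finset.Icc 1 n,
      (C : ℝ≥0∞)⁻¹ ≤ μ (adicChild n m k j₁) / μ (adicChild n m k j₂) ∧
        μ (adicChild n m k j₁) / μ (adicChild n m k j₂) ≤ C

/-- `μ` is doubling on `S`: there is a constant `C` with `μ (2I) ≤ C μ I` for every interval
`I = [c - r, c + r)` such that the interval `2I = [c - 2r, c + 2r)`, with the same midpoint and
twice the length, is contained in `S`. (Only intervals with `2I ⊆ S` are tested: for a measure
carried by `S`, failure near the boundary of `S` does not count as failure of doubling.) -/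
def IsDoublingOn (S : Set ℝ) (μ : Measure ℝ) : Prop :=
  ∃ C : ℝ≥0, 0 < C ∧ ∀ c r : ℝ, 0 < r → Ico (c - 2 * r) (c + 2 * r) ⊆ S →
    μ (Ico (c - 2 * r) (c + 2 * r)) ≤ C * μ (Ico (c - r) (c + r))

/-! The failure of doubling is hidden from all the `p`-adic grids. Take density `1` to the left of
`x` and, to its right, a bump reaching height about `N` at distance `h / N ^ 2`. This breaks
doubling near `x`, yet the logarithm of the bump is Lipschitz in the logarithm of the distance to
`x`. If `x` were a `p`-adic endpoint of level `n` with `p ^ (-n)` close to `h`, the `p`-adic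
intervals of level at least `n` would lie on one side of `x`, and longer ones would barely feel the
bump, whose mass is `O(h)` uniformly in `N`.

No point of `(0, 1)` is an endpoint for two primes, but `x = 1 / M` with `M = N ^ 4` almost is: if
`M ∣ p ^ n - 1`, it lies `1 / (M * p ^ n)` to the right of a level-`n` endpoint. This is about `h /
M`, the scale below which the bump is flat, so the shift is harmless (`bumpMeasure_adicChild_le`).
One `h` serves all `p ∈ P` by `exists_comparable_powers`. The constants do not depend on `M`, so a
weighted sum of bumps with `N → ∞` is `p`-adic doubling but not doubling
(`exists_adic_doubling_bumps`). Mixing it with Lebesgue measure gives infinitely many examples. -/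

/-! ### The bump profile: slow variation and stability under small shifts. -/

/-- A bump on `(1/M, 1)` of height about `M ^ (1/4)`, equal to `1` elsewhere, whose logarithm is
`1/2`-Lipschitz in `log t`. -/
noncomputable def bumpProfile (M t : ℝ) : ℝ := √(max 1 (min t⁻¹ (M * t)))

theorem one_le_bumpProfile (M t : ℝ) : 1 ≤ bumpProfile M t := by
  rw [bumpProfile, Real.one_le_sqrt]
  exact le_max_left _ _

theorem bumpProfile_eq_one_of_nonpos {M t : ℝ} (ht : t ≤ 0) : bumpProfile M t = 1 := by
  have : min t⁻¹ (M * t) ≤ 1 := (min_le_left _ _).trans ((inv_nonpos.2 ht).trans zero_le_one)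
  rw [bumpProfile, max_eq_left this, Real.sqrt_one]

theorem bumpProfile_eq_one_of_one_le {M t : ℝ} (ht : 1 ≤ t) : bumpProfile M t = 1 := by
  have : min t⁻¹ (M * t) ≤ 1 := (min_le_left _ _).trans (inv_le_one_of_one_le₀ ht)
  rw [bumpProfile, max_eq_left this, Real.sqrt_one]

theorem bumpProfile_le_sqrt_inv {M t : ℝ} (ht : 0 < t) (ht1 : t ≤ 1) :
    bumpProfile M t ≤ √(1 / t) := by
  apply Real.sqrt_le_sqrt
  rw [one_div]
  exact max_le (one_le_inv_iff₀.2 ⟨ht, ht1⟩) (min_le_left _ _)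

theorem bumpProfile_le_of_le {M s t : ℝ} (hs : 0 < s) (hst : s ≤ t) :
    bumpProfile M t ≤ √(t / s) * bumpProfile M s := by
  have ht := hs.trans_le hst
  have hc : 1 ≤ t / s := (one_le_div hs).2 hst
  rw [bumpProfile, bumpProfile, ← Real.sqrt_mul (by positivity)]
  apply Real.sqrt_le_sqrt
  rw [mul_max_of_nonneg _ _ (by positivity), mul_min_of_nonneg _ _ (by positivity)]
  refine max_le_max (by simpa using hc) (min_le_min ?_ ?_)
  · calc t⁻¹ ≤ s⁻¹ := inv_anti₀ hs hst
      _ ≤ t / s * s⁻¹ := le_mul_of_one_le_left (by positivity) hc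
  · apply le_of_eq
    field_simp

theorem bumpProfile_le_of_ge {M s t : ℝ} (hM : 0 ≤ M) (hs : 0 < s) (hst : s ≤ t) :
    bumpProfile M s ≤ √(t / s) * bumpProfile M t := by
  have ht := hs.trans_le hst
  have hc : 1 ≤ t / s := (one_le_div hs).2 hst
  rw [bumpProfile, bumpProfile, ← Real.sqrt_mul (by positivity)]
  apply Real.sqrt_le_sqrt
  rw [mul_max_of_nonneg _ _ (by positivity), mul_min_of_nonneg _ _ (by positivity)]
  refine max_le_max (by simpa using hc) (min_le_min ?_ ?_)
  · apply le_of_eq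
    field_simp
  · calc M * s ≤ M * t := by gcongr
      _ ≤ t / s * (M * t) := le_mul_of_one_le_left (by positivity) hc

theorem sqrt_le_two_mul_sqrt {a b : ℝ} (h : a ≤ 3 * b) (hb : 0 ≤ b) : √a ≤ 2 * √b := by
  rw [show (2 : ℝ) * √b = √(4 * b) by
    rw [Real.sqrt_mul (by norm_num), show (4 : ℝ) = 2 ^ 2 by norm_num, Real.sqrt_sq (by norm_num)]]
  exact Real.sqrt_le_sqrt (by linarith)

/-- The profile is flat up to `1 / M`, so a shift of order `1 / M` matters little: either `v - d ≥ v
/ 3`, or `M * v` is bounded and both values are of order `1`. -/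
theorem bumpProfile_sub_le {M d v : ℝ} (hM : 0 < M) (hd : 0 ≤ d) (hdM : M * d ≤ 2) :
    bumpProfile M (v - d) ≤ 2 * bumpProfile M v := by
  rcases le_or_gt v 0 with hv | hv
  · rw [bumpProfile_eq_one_of_nonpos (by linarith : v - d ≤ 0), bumpProfile_eq_one_of_nonpos hv]
    norm_num
  apply sqrt_le_two_mul_sqrt _ (by positivity)
  rw [mul_max_of_nonneg _ _ (by norm_num), mul_min_of_nonneg _ _ (by norm_num)]
  rcases le_or_gt (3 * d) (2 * v) with h | h
  · refine max_le_max (by norm_num) (min_le_min ?_ ?_)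
    · rw [← div_eq_mul_inv, ← one_div, div_le_div_iff₀ (by linarith) hv]
      linarith
    · nlinarith
  · refine max_le (le_max_of_le_left (by norm_num))
      (le_max_of_le_left ((min_le_right _ _).trans ?_))
    nlinarith

theorem bumpProfile_le_sub {M d v : ℝ} (hM : 0 < M) (hd : 0 ≤ d) (hdM : M * d ≤ 2) :
    bumpProfile M v ≤ 2 * bumpProfile M (v - d) := by
  rcases le_or_gt v 0 with hv | hv
  · rw [bumpProfile_eq_one_of_nonpos (by linarith : v - d ≤ 0), bumpProfile_eq_one_of_nonpos hv]
    norm_num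
  apply sqrt_le_two_mul_sqrt _ (by positivity)
  rw [mul_max_of_nonneg _ _ (by norm_num), mul_min_of_nonneg _ _ (by norm_num)]
  rcases le_or_gt (M * v) 3 with h | h
  · refine max_le (le_max_of_le_left (by norm_num))
      (le_max_of_le_left ((min_le_right _ _).trans ?_))
    linarith
  · have hvd : 3 * d < 2 * v := by
      by_contra! h'
      nlinarith
    refine max_le_max (by norm_num) (min_le_min ?_ ?_)
    · rw [← div_eq_mul_inv, ← one_div, div_le_div_iff₀ hv (by linarith)]
      linarith
    · nlinarith

/-- For `M = N ^ 4` the two branches `t⁻¹` and `M * t` cross at the peak `t = N ^ (-2)`, where the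
profile equals `N`. -/
theorem half_le_bumpProfile {N t : ℝ} (hN : 0 < N) (h1 : 1 / 2 ≤ N ^ 2 * t) (h2 : N ^ 2 * t ≤ 1) :
    N / 2 ≤ bumpProfile (N ^ 4) t := by
  have ht : 0 < t := by
    by_contra! h
    nlinarith [sq_nonneg N]
  apply Real.le_sqrt_of_sq_le
  refine le_max_of_le_right (le_min ?_ ?_)
  · rw [← one_div, le_div_iff₀ ht]
    nlinarith
  · have : N ^ 2 * (1 / 2) ≤ N ^ 2 * (N ^ 2 * t) := by gcongr
    nlinarith [sq_nonneg N]

/-! ### Integral estimates and the single-bump measure. -/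

theorem lintegral_sqrt_div_sub_le {e a b : ℝ} (hea : e ≤ a) (hab : a ≤ b) :
    ∫⁻ y in Ioc a b, ENNReal.ofReal √((b - e) / (y - e)) ≤ ENNReal.ofReal (2 * (b - a)) := by
  have hr : (-1 : ℝ) < -(1 / 2) := by norm_num
  have hint : IntervalIntegrable (fun y : ℝ => √(b - e) * (y - e) ^ (-(1 / 2) : ℝ)) volume a b := by
    have := (intervalIntegral.intervalIntegrable_rpow' (a := a - e) (b := b - e) hr).comp_sub_right e
    simp only [sub_add_cancel] at this
    exact this.const_mul _
  have hval : ∫ y in a..b, √(b - e) * (y - e) ^ (-(1 / 2) : ℝ)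
      = √(b - e) * (2 * (√(b - e) - √(a - e))) := by
    rw [intervalIntegral.integral_const_mul,
      intervalIntegral.integral_comp_sub_right (fun u : ℝ => u ^ (-(1 / 2) : ℝ)),
      integral_rpow (Or.inl hr), Real.sqrt_eq_rpow, Real.sqrt_eq_rpow,
      show (-(1 / 2) + 1 : ℝ) = 1 / 2 by norm_num]
    ring
  have hle : √(b - e) * (2 * (√(b - e) - √(a - e))) ≤ 2 * (b - a) := by
    have h1 := Real.mul_self_sqrt (sub_nonneg.2 (hea.trans hab))
    have h2 := Real.mul_self_sqrt (sub_nonneg.2 hea)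
    have h3 : √(a - e) ≤ √(b - e) := Real.sqrt_le_sqrt (by linarith)
    nlinarith [Real.sqrt_nonneg (a - e)]
  calc ∫⁻ y in Ioc a b, ENNReal.ofReal √((b - e) / (y - e))
      = ∫⁻ y in Ioc a b, ENNReal.ofReal (√(b - e) * (y - e) ^ (-(1 / 2) : ℝ)) := by
        refine setLIntegral_congr_fun measurableSet_Ioc fun y hy => ?_
        have hy0 : 0 < y - e := by linarith [hy.1]
        rw [Real.sqrt_div' _ hy0.le, Real.rpow_neg hy0.le, ← Real.sqrt_eq_rpow, div_eq_mul_inv]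
    _ = ENNReal.ofReal (∫ y in Ioc a b, √(b - e) * (y - e) ^ (-(1 / 2) : ℝ)) := by
        rw [ofReal_integral_eq_lintegral_ofReal]
        · exact (intervalIntegrable_iff_integrableOn_Ioc_of_le hab).1 hint
        · refine (ae_restrict_iff' measurableSet_Ioc).2 (ae_of_all _ fun y hy => ?_)
          have hy0 : 0 < y - e := by linarith [hy.1]
          simp only [Pi.zero_apply]
          positivity
    _ ≤ ENNReal.ofReal (2 * (b - a)) := by
        rw [← intervalIntegral.integral_of_le hab, hval]
        exact ENNReal.ofReal_le_ofReal hle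

/-- Both integrals are compared with the value `A` at the right end `b`. Above, the profile is at
most `A * √((b - e) / (y - e))`, an integrable singularity. Below, only the right half of `[a', b')`
is used, since there `b - e ≤ 2 * p * (y - e)` even if `a' = e`. -/
theorem setLIntegral_bumpProfile_le {M h e a b a' b' : ℝ} {p : ℕ} (hM : 0 ≤ M) (hh : 0 < h)
    (hp : 1 ≤ p) (hea : e ≤ a) (hab : a < b) (haa' : a ≤ a') (hbb' : b' ≤ b)
    (hlen : p * (b' - a') = b - a) :
    ∫⁻ y in Ico a b, ENNReal.ofReal (bumpProfile M ((y - e) / h)) ≤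
      ENNReal.ofReal (8 * p ^ 2) *
        ∫⁻ y in Ico a' b', ENNReal.ofReal (bumpProfile M ((y - e) / h)) := by
  have hp1 : (1 : ℝ) ≤ p := by exact_mod_cast hp
  have hp0 : (0 : ℝ) < p := by linarith
  set A : ℝ := bumpProfile M ((b - e) / h) with hA
  have hA1 : 1 ≤ A := one_le_bumpProfile _ _
  have hl : 0 < b' - a' := by
    by_contra! hneg
    nlinarith
  have hup : ∫⁻ y in Ico a b, ENNReal.ofReal (bumpProfile M ((y - e) / h)) ≤
      ENNReal.ofReal A * ENNReal.ofReal (2 * (b - a)) := by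
    rw [setLIntegral_congr Ico_ae_eq_Ioc]
    refine le_trans ?_ (mul_le_mul_right (lintegral_sqrt_div_sub_le hea hab.le) _)
    rw [← lintegral_const_mul' _ _ ENNReal.ofReal_ne_top]
    refine setLIntegral_mono' measurableSet_Ioc fun y hy => ?_
    rw [← ENNReal.ofReal_mul (by linarith)]
    apply ENNReal.ofReal_le_ofReal
    have hy0 : 0 < y - e := by linarith [hy.1]
    have := bumpProfile_le_of_ge hM (div_pos hy0 hh)
      (div_le_div_of_nonneg_right (by linarith [hy.2] : y - e ≤ b - e) hh.le)
    rw [div_div_div_cancel_right₀ hh.ne'] at this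
    rwa [mul_comm]
  have hlow : ENNReal.ofReal (A / (2 * p)) * ENNReal.ofReal ((b' - a') / 2) ≤
      ∫⁻ y in Ico a' b', ENNReal.ofReal (bumpProfile M ((y - e) / h)) := by
    calc ENNReal.ofReal (A / (2 * p)) * ENNReal.ofReal ((b' - a') / 2)
        = ∫⁻ _ in Ico ((a' + b') / 2) b', ENNReal.ofReal (A / (2 * p)) := by
          rw [setLIntegral_const, Real.volume_Ico]
          congr 2
          ring
      _ ≤ ∫⁻ y in Ico ((a' + b') / 2) b', ENNReal.ofReal (bumpProfile M ((y - e) / h)) := by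
          refine setLIntegral_mono' measurableSet_Ico fun y hy => ENNReal.ofReal_le_ofReal ?_
          have hy0 : 0 < y - e := by linarith [hy.1]
          have h1 := bumpProfile_le_of_le (M := M) (div_pos hy0 hh)
            (div_le_div_of_nonneg_right (by linarith [hy.2] : y - e ≤ b - e) hh.le)
          rw [div_div_div_cancel_right₀ hh.ne'] at h1
          have h2 : √((b - e) / (y - e)) ≤ 2 * p := by
            rw [Real.sqrt_le_left (by positivity), div_le_iff₀ hy0]
            have h3 : b - e ≤ (2 * p) * (y - e) := by nlinarith [hy.1]
            nlinarith
          rw [div_le_iff₀ (by positivity)]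
          nlinarith [one_le_bumpProfile M ((y - e) / h)]
      _ ≤ ∫⁻ y in Ico a' b', ENNReal.ofReal (bumpProfile M ((y - e) / h)) :=
          lintegral_mono_set (Ico_subset_Ico_left (by linarith))
  refine hup.trans (le_trans (le_of_eq ?_) (mul_le_mul_right hlow _))
  rw [← ENNReal.ofReal_mul (by linarith), ← ENNReal.ofReal_mul (by positivity),
    ← ENNReal.ofReal_mul (by positivity), ← hlen]
  congr 1
  field_simp
  ring

/-- The measure with a bump of width `h` to the right of `x`. -/
noncomputable def bumpMeasure (M h x : ℝ) : Measure ℝ :=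
  volume.withDensity fun y => ENNReal.ofReal (bumpProfile M ((y - x) / h))

theorem bumpMeasure_Ico (M h x a b : ℝ) : bumpMeasure M h x (Ico a b) =
    ∫⁻ y in Ico a b, ENNReal.ofReal (bumpProfile M ((y - x) / h)) :=
  withDensity_apply _ measurableSet_Ico

theorem volume_le_bumpMeasure (M h x : ℝ) : volume ≤ bumpMeasure M h x := by
  refine Measure.le_iff.2 fun s hs => ?_
  rw [bumpMeasure, withDensity_apply _ hs, ← setLIntegral_one]
  exact lintegral_mono fun y => ENNReal.one_le_ofReal.2 (one_le_bumpProfile _ _)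

theorem bumpMeasure_Ico_eq_volume {M h x a b : ℝ} (hh : 0 < h) (hab : b ≤ x ∨ x + h ≤ a) :
    bumpMeasure M h x (Ico a b) = volume (Ico a b) := by
  rw [bumpMeasure_Ico, ← setLIntegral_one]
  refine setLIntegral_congr_fun measurableSet_Ico fun y hy => ?_
  have : bumpProfile M ((y - x) / h) = 1 := by
    rcases hab with hb | ha
    · exact bumpProfile_eq_one_of_nonpos
        (div_nonpos_of_nonpos_of_nonneg (by linarith [hy.2]) hh.le)
    · exact bumpProfile_eq_one_of_one_le ((one_le_div hh).2 (by linarith [hy.1]))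
  simp only [this, ENNReal.ofReal_one]

/-- The bump lies under `√(h / (y - x))`, so its mass is bounded independently of `M`. -/
theorem bumpMeasure_Ico_le {M h x a b : ℝ} (hh : 0 < h) :
    bumpMeasure M h x (Ico a b) ≤ volume (Ico a b) + ENNReal.ofReal (2 * h) := by
  have hU := lintegral_sqrt_div_sub_le (e := x) (a := x) (b := x + h) le_rfl (by linarith)
  simp only [add_sub_cancel_left] at hU
  rw [bumpMeasure_Ico]
  calc ∫⁻ y in Ico a b, ENNReal.ofReal (bumpProfile M ((y - x) / h))
      ≤ ∫⁻ y in Ico a b, (1 +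
          (Ioc x (x + h)).indicator (fun y => ENNReal.ofReal √(h / (y - x))) y) := by
        refine lintegral_mono fun y => ?_
        by_cases hy : y ∈ Ioc x (x + h)
        · rw [indicator_of_mem hy]
          refine le_add_left (ENNReal.ofReal_le_ofReal ?_)
          have := bumpProfile_le_sqrt_inv (M := M) (div_pos (sub_pos.2 hy.1) hh)
            ((div_le_one hh).2 (by linarith [hy.2]))
          rwa [one_div_div] at this
        · have : bumpProfile M ((y - x) / h) = 1 := by
            rcases le_or_gt y x with h1 | h1
            · exact bumpProfile_eq_one_of_nonpos
                (div_nonpos_of_nonpos_of_nonneg (by linarith) hh.le)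
            · refine bumpProfile_eq_one_of_one_le ((one_le_div hh).2 ?_)
              by_contra! h2
              exact hy ⟨h1, by linarith⟩
          rw [this, ENNReal.ofReal_one]
          exact le_self_add
    _ = volume (Ico a b) + ∫⁻ y in Ico a b,
          (Ioc x (x + h)).indicator (fun y => ENNReal.ofReal √(h / (y - x))) y := by
        rw [lintegral_add_left measurable_const, setLIntegral_one]
    _ ≤ volume (Ico a b) + ∫⁻ y,
          (Ioc x (x + h)).indicator (fun y => ENNReal.ofReal √(h / (y - x))) y := by
        gcongr
        exact Measure.restrict_le_self
    _ ≤ _ := by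
        rw [lintegral_indicator measurableSet_Ioc]
        gcongr

/-! ### One bump against the `p`-adic grid. -/

theorem volume_adicChild (n : ℕ) (m k : ℤ) (j : ℕ) :
    volume (adicChild n m k j) = ENNReal.ofReal (((n : ℝ) ^ (m + 1))⁻¹) := by
  rw [adicChild, Real.volume_Ico]
  congr 1
  ring

theorem adicChild_bounds {n : ℕ} (hn : 0 < n) (m k : ℤ) {j : ℕ} (hj : j ∈ Finset.Icc 1 n) :
    ((k : ℝ) - 1) / (n : ℝ) ^ m ≤ ((k : ℝ) - 1) / (n : ℝ) ^ m + ((j : ℝ) - 1) / (n : ℝ) ^ (m + 1) ∧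
    ((k : ℝ) - 1) / (n : ℝ) ^ m + (j : ℝ) / (n : ℝ) ^ (m + 1) ≤ (k : ℝ) / (n : ℝ) ^ m := by
  rw [Finset.mem_Icc] at hj
  have h1 : (1 : ℝ) ≤ j := by exact_mod_cast hj.1
  have h2 : (j : ℝ) ≤ n := by exact_mod_cast hj.2
  have hn0 : (0 : ℝ) < n := by positivity
  constructor
  · have : 0 ≤ ((j : ℝ) - 1) / (n : ℝ) ^ (m + 1) := div_nonneg (by linarith) (by positivity)
    linarith
  · have : (j : ℝ) / (n : ℝ) ^ (m + 1) ≤ 1 / (n : ℝ) ^ m := by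
      rw [zpow_add_one₀ hn0.ne', div_le_div_iff₀ (by positivity) (by positivity)]
      nlinarith [zpow_pos hn0 m]
    have e : (k : ℝ) / (n : ℝ) ^ m = ((k : ℝ) - 1) / (n : ℝ) ^ m + 1 / (n : ℝ) ^ m := by ring
    linarith

theorem adicChild_subset {n : ℕ} (hn : 0 < n) (m k : ℤ) {j : ℕ} (hj : j ∈ Finset.Icc 1 n) :
    adicChild n m k j ⊆ adicInterval n m k :=
  Ico_subset_Ico (adicChild_bounds hn m k hj).1 (adicChild_bounds hn m k hj).2

theorem bumpMeasure_adicChild_le {M n p : ℕ} {h : ℝ} (hM : 0 < M) (hp : 1 < p)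
    (hdvd : M ∣ p ^ n - 1) (hh : 0 < h) (hle : h ≤ ((p : ℝ) ^ n)⁻¹)
    (hge : ((p : ℝ) ^ n)⁻¹ ≤ 2 * h) (m k : ℤ) {i j : ℕ}
    (hi : i ∈ Finset.Icc 1 p) (hj : j ∈ Finset.Icc 1 p) :
    bumpMeasure M h (1 / M) (adicChild p m k i) ≤
      ENNReal.ofReal (32 * p ^ 2) * bumpMeasure M h (1 / M) (adicChild p m k j) := by
  have hp0 : 0 < p := by omega
  have hp1 : (1 : ℝ) < p := by exact_mod_cast hp
  have hM0 : (0 : ℝ) < M := by exact_mod_cast hM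
  have hq0 : (0 : ℝ) < (p : ℝ) ^ n := by positivity
  have hvol : volume (adicChild p m k j) ≤ bumpMeasure M h (1 / M) (adicChild p m k j) :=
    volume_le_bumpMeasure _ _ _ _
  -- For `m < n` the children have length at least `h`, so the bump's mass is absorbed by Lebesgue
  -- measure.
  rcases lt_or_ge m n with hmn | hmn
  · refine le_trans ?_ (mul_le_mul_right hvol _)
    have hlen : h ≤ ((p : ℝ) ^ (m + 1))⁻¹ := by
      refine hle.trans (inv_anti₀ (by positivity) ?_)
      rw [← zpow_natCast]
      exact zpow_le_zpow_right₀ hp1.le (by omega)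
    calc bumpMeasure M h (1 / M) (adicChild p m k i)
        ≤ volume (adicChild p m k i) + ENNReal.ofReal (2 * h) := bumpMeasure_Ico_le hh
      _ ≤ ENNReal.ofReal (32 * p ^ 2) * volume (adicChild p m k j) := by
        rw [volume_adicChild, volume_adicChild, ← ENNReal.ofReal_add (by positivity)
          (by positivity), ← ENNReal.ofReal_mul (by positivity)]
        apply ENNReal.ofReal_le_ofReal
        have h3 : 3 * ((p : ℝ) ^ (m + 1))⁻¹ ≤ 32 * p ^ 2 * ((p : ℝ) ^ (m + 1))⁻¹ := by
          gcongr
          nlinarith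
        linarith
  obtain ⟨c, hc⟩ := hdvd
  have hc' : (M : ℝ) * c = (p : ℝ) ^ n - 1 := by
    have : p ^ n = M * c + 1 := by
      have := Nat.one_le_pow n p hp0
      omega
    have : (p : ℝ) ^ n = M * c + 1 := by exact_mod_cast this
    linarith
  obtain ⟨s, rfl⟩ : ∃ s : ℕ, m = n + s := ⟨(m - n).toNat, by omega⟩
  -- `e` is the level-`n` endpoint just left of `1 / M`; `d` is their distance in units of `h`.
  set e : ℝ := c / (p : ℝ) ^ n with he
  set d : ℝ := 1 / (M * p ^ n * h) with hd
  have hd0 : 0 ≤ d := by positivity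
  have hMd : M * d ≤ 2 := by
    rw [hd]
    have : (M : ℝ) * (1 / (M * p ^ n * h)) = ((p : ℝ) ^ n)⁻¹ / h := by field_simp
    rw [this, div_le_iff₀ hh]
    exact hge
  have hx : ∀ y : ℝ, (y - 1 / M) / h = (y - e) / h - d := by
    intro y
    rw [he, hd, (eq_div_iff hM0.ne').2 (by linarith [hc'] : (c : ℝ) * M = (p : ℝ) ^ n - 1)]
    field_simp
    ring
  have hex : e ≤ 1 / M := by
    have h0 := hx (1 / M)
    rw [sub_self, zero_div] at h0
    have h1 : 0 ≤ (1 / (M : ℝ) - e) / h := by linarith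
    rw [le_div_iff₀ hh] at h1
    linarith
  have hpow : (p : ℝ) ^ ((n : ℤ) + s) = p ^ n * p ^ s := by
    rw [zpow_add₀ (by positivity), zpow_natCast, zpow_natCast]
  have hee : e = ((c * p ^ s : ℤ) : ℝ) / (p : ℝ) ^ ((n : ℤ) + s) := by
    rw [hpow, he]
    push_cast
    field_simp
  have hP0 : (0 : ℝ) < (p : ℝ) ^ ((n : ℤ) + s) := by positivity
  -- As `e` is also an endpoint at level `n + s`, the interval lies entirely on one side of it.
  rcases le_or_gt k (c * p ^ s) with hk | hk
  · have hke : (k : ℝ) / (p : ℝ) ^ ((n : ℤ) + s) ≤ e := by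
      rw [hee]
      gcongr
    have heq : bumpMeasure M h (1 / M) (adicChild p (n + s) k i) =
        volume (adicChild p (n + s) k i) :=
      bumpMeasure_Ico_eq_volume hh (Or.inl (((adicChild_bounds hp0 _ k hi).2.trans hke).trans hex))
    rw [heq, volume_adicChild, ← volume_adicChild p (n + s) k j]
    refine hvol.trans (le_mul_of_one_le_left zero_le (ENNReal.one_le_ofReal.2 ?_))
    nlinarith
  · have hke : e ≤ ((k : ℝ) - 1) / (p : ℝ) ^ ((n : ℤ) + s) := by
      rw [hee]
      gcongr
      have : c * p ^ s ≤ k - 1 := by omega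
      exact_mod_cast this
    obtain ⟨h1, h2⟩ := adicChild_bounds hp0 (n + s) k hj
    have hlt : ((k : ℝ) - 1) / (p : ℝ) ^ ((n : ℤ) + s) < k / (p : ℝ) ^ ((n : ℤ) + s) := by
      gcongr
      linarith
    calc bumpMeasure M h (1 / M) (adicChild p (n + s) k i)
        ≤ bumpMeasure M h (1 / M) (adicInterval p (n + s) k) :=
          measure_mono (adicChild_subset hp0 _ _ hi)
      _ ≤ ∫⁻ y in adicInterval p (n + s) k,
            ENNReal.ofReal 2 * ENNReal.ofReal (bumpProfile M ((y - e) / h)) := by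
          rw [adicInterval, bumpMeasure_Ico]
          refine lintegral_mono fun y => ?_
          rw [← ENNReal.ofReal_mul two_pos.le, hx]
          exact ENNReal.ofReal_le_ofReal (bumpProfile_sub_le hM0 hd0 hMd)
      _ ≤ ENNReal.ofReal 2 * (ENNReal.ofReal (8 * p ^ 2) *
            ∫⁻ y in adicChild p (n + s) k j, ENNReal.ofReal (bumpProfile M ((y - e) / h))) := by
          rw [lintegral_const_mul' _ _ ENNReal.ofReal_ne_top]
          gcongr
          refine setLIntegral_bumpProfile_le hM0.le hh hp.le hke hlt h1 h2 ?_
          rw [zpow_add_one₀ (by positivity)]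
          field_simp
          ring
      _ ≤ ENNReal.ofReal 2 * (ENNReal.ofReal (8 * p ^ 2) * (ENNReal.ofReal 2 *
            bumpMeasure M h (1 / M) (adicChild p (n + s) k j))) := by
          rw [adicChild, bumpMeasure_Ico,
            ← lintegral_const_mul' (ENNReal.ofReal 2) _ ENNReal.ofReal_ne_top]
          refine mul_le_mul_right (mul_le_mul_right (lintegral_mono fun y => ?_) _) _
          rw [← ENNReal.ofReal_mul two_pos.le, hx]
          exact ENNReal.ofReal_le_ofReal (bumpProfile_le_sub hM0 hd0 hMd)
      _ = ENNReal.ofReal (32 * p ^ 2) *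
            bumpMeasure M h (1 / M) (adicChild p (n + s) k j) := by
          rw [← mul_assoc, ← mul_assoc, ← ENNReal.ofReal_mul (by positivity),
            ← ENNReal.ofReal_mul (by positivity)]
          congr 2
          ring

/-! ### Simultaneous approximation by pigeonhole. -/

/-- Powers of finitely many integers, with exponents divisible by `L`, can be simultaneously
arbitrarily large and within a factor `2` of each other. -/
theorem exists_comparable_powers (P : Finset ℕ) (hP : ∀ p ∈ P, 1 < p) {L : ℕ} (hL : 0 < L)
    {ε : ℝ} (hε : 0 < ε) :
    ∃ h : ℝ, 0 < h ∧ h < ε ∧ ∀ p ∈ P, ∃ n : ℕ, L ∣ n ∧ h ≤ ((p : ℝ) ^ n)⁻¹ ∧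
      ((p : ℝ) ^ n)⁻¹ ≤ 2 * h := by
  have hlog : ∀ p ∈ P, 0 < (L : ℝ) * Real.log p := fun p hp =>
    mul_pos (by exact_mod_cast hL) (Real.log_pos (by exact_mod_cast hP p hp))
  set δ : ℝ := Real.log 2 / 2 with hδ
  have hδ0 : 0 < δ := half_pos (Real.log_pos one_lt_two)
  set B : ℕ := ⌈∑ p ∈ P, (L : ℝ) * Real.log p / δ⌉₊ + 1 with hB
  have hB0 : (0 : ℝ) < B := by positivity
  have hBp : ∀ p ∈ P, (L : ℝ) * Real.log p ≤ B * δ := by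
    intro p hp
    rw [← div_le_iff₀ hδ0]
    have h1 := Finset.single_le_sum (f := fun p : ℕ => (L : ℝ) * Real.log p / δ)
      (fun i hi => (div_pos (hlog i hi) hδ0).le) hp
    have h2 := Nat.le_ceil (∑ p ∈ P, (L : ℝ) * Real.log p / δ)
    rw [hB]
    push_cast
    linarith
  -- Times in the same cell differ by nearly a multiple of `L * log p` for every `p`, with error at
  -- most `δ`.
  let cell : ℕ → P → Fin B := fun T p =>
    ⟨⌊(B : ℝ) * Int.fract ((T : ℝ) / (L * Real.log (p : ℕ)))⌋₊, by
      rw [Nat.floor_lt (by positivity)]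
      nlinarith [Int.fract_lt_one ((T : ℝ) / (L * Real.log (p : ℕ)))]⟩
  obtain ⟨c, hc⟩ := Finite.exists_infinite_fiber cell
  rw [Set.infinite_coe_iff] at hc
  obtain ⟨T₁, hT₁⟩ := hc.nonempty
  obtain ⟨T₂, hT₂, hlt⟩ := hc.exists_gt (T₁ + ⌈-Real.log ε⌉₊)
  have hT : -Real.log ε < (T₂ : ℝ) - T₁ := by
    have h1 := Nat.le_ceil (-Real.log ε)
    have h2 : (T₁ : ℝ) + (⌈-Real.log ε⌉₊ : ℕ) < T₂ := by exact_mod_cast hlt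
    linarith
  have hT12 : (T₁ : ℝ) ≤ T₂ := by exact_mod_cast (by omega : T₁ ≤ T₂)
  -- The extra `δ` makes the error one-sided; the total spread is `2 * δ = log 2`, hence the factor
  -- `2`.
  refine ⟨Real.exp (-(T₂ - T₁) - δ), Real.exp_pos _, ?_, fun p hp => ?_⟩
  · rw [← Real.lt_log_iff_exp_lt hε]
    linarith
  · set l : ℝ := L * Real.log p with hl
    have hl0 : 0 < l := hlog p hp
    have hcell : ⌊(B : ℝ) * Int.fract ((T₂ : ℝ) / l)⌋₊ = ⌊(B : ℝ) * Int.fract ((T₁ : ℝ) / l)⌋₊ := by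
      have h : cell T₂ = cell T₁ := hT₂.trans hT₁.symm
      exact congrArg (fun g : P → Fin B => (g ⟨p, hp⟩ : ℕ)) h
    have hf : |(B : ℝ) * Int.fract ((T₂ : ℝ) / l) - B * Int.fract ((T₁ : ℝ) / l)| < 1 := by
      have a1 := Nat.floor_le (mul_nonneg hB0.le (Int.fract_nonneg ((T₁ : ℝ) / l)))
      have a2 := Nat.lt_floor_add_one ((B : ℝ) * Int.fract ((T₁ : ℝ) / l))
      have b1 := Nat.floor_le (mul_nonneg hB0.le (Int.fract_nonneg ((T₂ : ℝ) / l)))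
      have b2 := Nat.lt_floor_add_one ((B : ℝ) * Int.fract ((T₂ : ℝ) / l))
      rw [hcell] at b1 b2
      rw [abs_lt]
      constructor <;> linarith
    have hmono : ⌊(T₁ : ℝ) / l⌋ ≤ ⌊(T₂ : ℝ) / l⌋ := Int.floor_mono (by gcongr)
    obtain ⟨k, hk⟩ := Int.eq_ofNat_of_zero_le (sub_nonneg.2 hmono)
    have hk' : (⌊(T₂ : ℝ) / l⌋ : ℝ) - ⌊(T₁ : ℝ) / l⌋ = k := by exact_mod_cast hk
    have hclose : |((T₂ : ℝ) - T₁) - k * l| ≤ δ := by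
      have e : ((T₂ : ℝ) - T₁) - k * l
          = (B * Int.fract ((T₂ : ℝ) / l) - B * Int.fract ((T₁ : ℝ) / l)) * (l / B) := by
        rw [← hk', Int.fract, Int.fract]
        field_simp
        ring
      rw [e, abs_mul, abs_of_pos (div_pos hl0 hB0)]
      have : l / B ≤ δ := by
        rw [div_le_iff₀ hB0, mul_comm]
        exact hBp p hp
      nlinarith [div_pos hl0 hB0]
    rw [abs_le] at hclose
    have hpow : ((p : ℝ) ^ (L * k))⁻¹ = Real.exp (-(k * l)) := by
      have hp0 : (0 : ℝ) < p := by exact_mod_cast (zero_lt_one.trans (hP p hp))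
      rw [Real.exp_neg, ← Real.exp_log (pow_pos hp0 (L * k)), Real.log_pow, hl]
      push_cast
      ring_nf
    refine ⟨L * k, Dvd.intro _ rfl, ?_, ?_⟩
    · rw [hpow, Real.exp_le_exp]
      linarith [hclose.2]
    · rw [hpow]
      calc Real.exp (-(k * l)) ≤ Real.exp (Real.log 2 + (-(T₂ - T₁) - δ)) := ?_
        _ = 2 * Real.exp (-(T₂ - T₁) - δ) := by rw [Real.exp_add, Real.exp_log two_pos]
      rw [Real.exp_le_exp]
      linarith [hclose.1]

theorem isAdicDoublingOn_of_le {S : Set ℝ} {n : ℕ} {μ : Measure ℝ} [IsFiniteMeasure μ] {C : ℝ≥0}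
    (hC : 0 < C) (h : ∀ m k : ℤ, adicInterval n m k ⊆ S → ∀ i ∈ Finset.Icc 1 n,
      ∀ j ∈ Finset.Icc 1 n, μ (adicChild n m k i) ≤ C * μ (adicChild n m k j))
    (h0 : ∀ m k : ℤ, adicInterval n m k ⊆ S → ∀ j ∈ Finset.Icc 1 n, μ (adicChild n m k j) ≠ 0) :
    IsAdicDoublingOn S n μ := by
  refine ⟨C, hC, fun m k hS i hi j hj => ⟨?_, ENNReal.div_le_of_le_mul (h m k hS i hi j hj)⟩⟩
  rw [ENNReal.le_div_iff_mul_le (Or.inl (h0 m k hS j hj)) (Or.inl (measure_ne_top _ _)),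
    mul_comm, ← div_eq_mul_inv]
  exact ENNReal.div_le_of_le_mul' (h m k hS j hj i hi)

theorem dvd_pow_sub_one_of_totient_dvd {M p n : ℕ} (hp : 0 < p) (h : p.Coprime M)
    (hn : M.totient ∣ n) : M ∣ p ^ n - 1 := by
  obtain ⟨k, rfl⟩ := hn
  rw [← Nat.modEq_iff_dvd' (Nat.one_le_pow _ _ hp), pow_mul]
  simpa using ((Nat.ModEq.pow_totient h).pow k).symm

/-! ### Superposing the bumps. -/

/-- The geometric weights used to superpose countably many measures. -/
noncomputable def dyadicWeight (i : ℕ) : ℝ≥0∞ := ENNReal.ofReal ((1 / 2) ^ (i + 1))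

theorem tsum_dyadicWeight : ∑' i, dyadicWeight i = 1 := by
  have h : HasSum (fun i : ℕ => ((1 : ℝ) / 2) ^ (i + 1)) 1 := by
    simpa [pow_succ] using hasSum_geometric_two.mul_right ((1 : ℝ) / 2)
  simp only [dyadicWeight]
  rw [← ENNReal.ofReal_tsum_of_nonneg (fun i => by positivity) h.summable, h.tsum_eq,
    ENNReal.ofReal_one]

/-- A superposition of bump measures with bumps at `1 / M i` of width `h i`. -/
noncomputable def bumpSum (M h : ℕ → ℝ) : Measure ℝ :=
  Measure.sum fun i => dyadicWeight i • bumpMeasure (M i) (h i) (1 / M i)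

theorem bumpSum_apply (M h : ℕ → ℝ) {s : Set ℝ} (hs : MeasurableSet s) :
    bumpSum M h s = ∑' i, dyadicWeight i * bumpMeasure (M i) (h i) (1 / M i) s := by
  simp [bumpSum, Measure.sum_apply _ hs]

theorem volume_le_bumpSum (M h : ℕ → ℝ) : volume ≤ bumpSum M h := by
  refine Measure.le_iff.2 fun s hs => ?_
  rw [bumpSum_apply M h hs, ← one_mul (volume s), ← tsum_dyadicWeight, ← ENNReal.tsum_mul_right]
  exact ENNReal.tsum_le_tsum fun i => mul_le_mul_right (volume_le_bumpMeasure _ _ _ s) _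

theorem bumpSum_unit_lt_top {M h : ℕ → ℝ} (hh : ∀ i, 0 < h i) (h1 : ∀ i, h i ≤ 1) :
    bumpSum M h (Ico 0 1) < ⊤ := by
  have : bumpSum M h (Ico 0 1) ≤ 3 := by
    rw [bumpSum_apply M h measurableSet_Ico, ← one_mul 3, ← tsum_dyadicWeight,
      ← ENNReal.tsum_mul_right]
    refine ENNReal.tsum_le_tsum fun i => mul_le_mul_right ((bumpMeasure_Ico_le (hh i)).trans ?_) _
    rw [Real.volume_Ico, ← ENNReal.ofReal_add (by norm_num) (by linarith [hh i]),
      show (3 : ℝ≥0∞) = ENNReal.ofReal 3 by norm_num]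
    exact ENNReal.ofReal_le_ofReal (by linarith [h1 i])
  exact this.trans_lt (by norm_num)

theorem bumpSum_Ico_eq_volume {M h : ℕ → ℝ} {a b : ℝ} (hh : ∀ i, 0 < h i)
    (hab : ∀ i, b ≤ 1 / M i ∨ 1 / M i + h i ≤ a) :
    bumpSum M h (Ico a b) = volume (Ico a b) := by
  rw [bumpSum_apply M h measurableSet_Ico,
    tsum_congr fun i => by rw [bumpMeasure_Ico_eq_volume (hh i) (hab i)],
    ENNReal.tsum_mul_right, tsum_dyadicWeight, one_mul]

/-- The right half of `[x, x + r)`, with `x = 1 / M i` and `r = h i / N ^ 2`, already carries enough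
mass: the density of the `i`-th bump there is at least `N / 2`. -/
theorem lt_bumpSum_Ico {M h : ℕ → ℝ} {i : ℕ} {N C : ℝ} (hC : 0 ≤ C) (hN : 0 < N)
    (hM : M i = N ^ 4) (hh : 0 < h i) (hCN : 8 * 2 ^ (i + 1) * C < N) :
    ENNReal.ofReal C *
      volume (Ico (1 / M i - 2 * (h i / N ^ 2)) (1 / M i)) <
      bumpSum M h (Ico (1 / M i - 3 * (h i / N ^ 2)) (1 / M i + h i / N ^ 2)) := by
  set r : ℝ := h i / N ^ 2 with hr
  have hr0 : 0 < r := by positivity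
  calc ENNReal.ofReal C * volume (Ico (1 / M i - 2 * r) (1 / M i))
      = ENNReal.ofReal (C * (2 * r)) := by
        rw [Real.volume_Ico, ← ENNReal.ofReal_mul hC]
        ring_nf
    _ < ENNReal.ofReal ((1 / 2) ^ (i + 1) * (N / 2 * (r / 2))) := by
        rw [ENNReal.ofReal_lt_ofReal_iff (by positivity), one_div, inv_pow, ← div_eq_inv_mul,
          lt_div_iff₀ (by positivity)]
        nlinarith
    _ = dyadicWeight i * ∫⁻ _ in Ico (1 / M i + r / 2) (1 / M i + r), ENNReal.ofReal (N / 2) := by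
        rw [setLIntegral_const, Real.volume_Ico, ENNReal.ofReal_mul (by positivity),
          ENNReal.ofReal_mul (by positivity), dyadicWeight]
        ring_nf
    _ ≤ dyadicWeight i *
          bumpMeasure (M i) (h i) (1 / M i) (Ico (1 / M i + r / 2) (1 / M i + r)) := by
        rw [bumpMeasure_Ico]
        refine mul_le_mul_right (setLIntegral_mono' measurableSet_Ico fun y hy =>
          ENNReal.ofReal_le_ofReal ?_) _
        have hu : N ^ 2 * ((y - 1 / M i) / h i) = (y - 1 / M i) / r := by
          rw [hr]
          field_simp
        nth_rewrite 1 [hM]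
        refine half_le_bumpProfile hN ?_ ?_
        · rw [hu, le_div_iff₀ hr0]
          linarith [hy.1]
        · rw [hu, div_le_iff₀ hr0]
          linarith [hy.2]
    _ ≤ dyadicWeight i *
          bumpMeasure (M i) (h i) (1 / M i) (Ico (1 / M i - 3 * r) (1 / M i + r)) := by
        gcongr
        linarith
    _ ≤ bumpSum M h (Ico (1 / M i - 3 * r) (1 / M i + r)) := by
        rw [bumpSum_apply M h measurableSet_Ico]
        exact ENNReal.le_tsum i

theorem bumpSum_adicChild_le {M : ℕ → ℕ} {h : ℕ → ℝ} {p : ℕ} (hp : 1 < p) (hM : ∀ i, 0 < M i)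
    (hh : ∀ i, 0 < h i)
    (hq : ∀ i, ∃ n : ℕ, M i ∣ p ^ n - 1 ∧ h i ≤ ((p : ℝ) ^ n)⁻¹ ∧ ((p : ℝ) ^ n)⁻¹ ≤ 2 * h i)
    (m k : ℤ) {i j : ℕ} (hi : i ∈ Finset.Icc 1 p) (hj : j ∈ Finset.Icc 1 p) :
    bumpSum (fun a => M a) h (adicChild p m k i) ≤
      ENNReal.ofReal (32 * p ^ 2) * bumpSum (fun a => M a) h (adicChild p m k j) := by
  rw [bumpSum_apply (s := adicChild p m k i) _ _ measurableSet_Ico,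
    bumpSum_apply (s := adicChild p m k j) _ _ measurableSet_Ico, ← ENNReal.tsum_mul_left]
  refine ENNReal.tsum_le_tsum fun a => ?_
  obtain ⟨n, hn, hle, hge⟩ := hq a
  rw [mul_left_comm]
  exact mul_le_mul_right (bumpMeasure_adicChild_le (hM a) hp hn (hh a) hle hge m k hi hj) _

theorem exists_adic_doubling_bumps (P : Finset ℕ) (hP : ∀ p ∈ P, p.Prime) :
    ∃ μ : Measure ℝ, IsFiniteMeasure μ ∧ μ (Ico (0 : ℝ) 1)ᶜ = 0 ∧
      volume.restrict (Ico (0 : ℝ) 1) ≤ μ ∧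
      (∀ p ∈ P, ∀ m k : ℤ, adicInterval p m k ⊆ Ico 0 1 → ∀ i ∈ Finset.Icc 1 p,
        ∀ j ∈ Finset.Icc 1 p,
          μ (adicChild p m k i) ≤ ENNReal.ofReal (32 * p ^ 2) * μ (adicChild p m k j)) ∧
      ∀ C : ℝ≥0, ∃ c r : ℝ, 0 < r ∧ Ico (c - 2 * r) (c + 2 * r) ⊆ Ico 0 1 ∧
        μ (Ico (c - r) (c + r)) = volume (Ico (c - r) (c + r)) ∧
        C * volume (Ico (c - r) (c + r)) < μ (Ico (c - 2 * r) (c + 2 * r)) := by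
  -- `B` is coprime to every `p ∈ P`, and `B > 4` lets `N = B ^ (i + 1)` outgrow both the weight `2
  -- ^ (-(i + 1))` and `C`.
  set B : ℕ := 4 * (∏ p ∈ P, p) + 1 with hB
  have hprod : 0 < ∏ p ∈ P, p := Finset.prod_pos fun p hp => (hP p hp).pos
  have hB5 : 5 ≤ B := by omega
  have hBr : (5 : ℝ) ≤ B := by exact_mod_cast hB5
  have hcop : ∀ p ∈ P, p.Coprime B := fun p hp => by
    have hd : p ∣ 4 * ∏ p ∈ P, p := (Finset.dvd_prod_of_mem _ hp).mul_left 4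
    rw [hB, Nat.Coprime, Nat.gcd_comm, ← Nat.Coprime]
    exact Nat.Coprime.coprime_dvd_right hd (by simp)
  let M : ℕ → ℕ := fun i => (B ^ (i + 1)) ^ 4
  have hM0 : ∀ i, 0 < M i := fun i => by positivity
  have hM0' : ∀ i, (0 : ℝ) < M i := fun i => by exact_mod_cast hM0 i
  have hM5 : ∀ i, (5 : ℝ) ≤ M i := fun i => by
    have : B ^ 1 ≤ M i := by
      simp only [M, ← pow_mul]
      exact Nat.pow_le_pow_right (by omega) (by omega)
    have : (B : ℝ) ≤ M i := by exact_mod_cast (pow_one B ▸ this)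
    linarith
  choose h hh hlt hq using fun i => exists_comparable_powers P (fun p hp => (hP p hp).one_lt)
    (Nat.totient_pos.2 (hM0 i)) (ε := 1 / (8 * M i)) (by have := hM0' i; positivity)
  have hlt' : ∀ i, h i < 1 / M i / 8 := fun i => by
    have := hlt i
    rwa [mul_comm, ← div_div] at this
  have hx5 : ∀ i, 1 / (M i : ℝ) ≤ 1 / 5 := fun i => one_div_le_one_div_of_le (by norm_num) (hM5 i)
  refine ⟨(bumpSum (fun i => M i) h).restrict (Ico 0 1), ⟨?_⟩, ?_, ?_, ?_, ?_⟩
  · rw [Measure.restrict_apply_univ]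
    exact bumpSum_unit_lt_top hh fun i => by linarith [hlt' i, hx5 i]
  · rw [Measure.restrict_apply measurableSet_Ico.compl, compl_inter_self, measure_empty]
  · exact Measure.restrict_mono le_rfl (volume_le_bumpSum _ _)
  · intro p hp m k hS i hi j hj
    have hp0 := (hP p hp).pos
    rw [Measure.restrict_eq_self _ ((adicChild_subset hp0 m k hi).trans hS),
      Measure.restrict_eq_self _ ((adicChild_subset hp0 m k hj).trans hS)]
    refine bumpSum_adicChild_le (hP p hp).one_lt hM0 hh (fun a => ?_) m k hi hj
    obtain ⟨n, hn, hn'⟩ := hq a p hp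
    exact ⟨n, dvd_pow_sub_one_of_totient_dvd hp0 (((hcop p hp).pow_right _).pow_right _) hn, hn'⟩
  · intro C
    obtain ⟨i, hi⟩ := exists_nat_gt (8 * (C : ℝ))
    have hi2 : 8 * (C : ℝ) < 2 ^ (i + 1) := by
      have h1 : ((i + 1 : ℕ) : ℝ) < 2 ^ (i + 1) := by exact_mod_cast Nat.lt_two_pow_self
      push_cast at h1
      linarith
    set N : ℝ := (B : ℝ) ^ (i + 1) with hN
    have hN1 : 1 ≤ N := one_le_pow₀ (by linarith)
    have hMN : (M i : ℝ) = N ^ 4 := by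
      simp only [M, hN]
      push_cast
      rfl
    have hCN : 8 * 2 ^ (i + 1) * (C : ℝ) < N := by
      have h1 : (2 : ℝ) ^ (i + 1) * 2 ^ (i + 1) ≤ N := by
        rw [hN, ← mul_pow]
        gcongr
        linarith
      nlinarith [pow_pos (two_pos : (0 : ℝ) < 2) (i + 1)]
    set r : ℝ := h i / N ^ 2 with hr
    have hr0 : 0 < r := div_pos (hh i) (by positivity)
    have hrh : r ≤ h i := div_le_self (hh i).le (one_le_pow₀ hN1)
    have hS : Ico (1 / M i - 3 * r) (1 / M i + r) ⊆ Ico (0 : ℝ) 1 :=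
      Ico_subset_Ico (by linarith [hlt' i]) (by linarith [hlt' i, hx5 i])
    have e1 : 1 / (M i : ℝ) - r - 2 * r = 1 / M i - 3 * r := by ring
    have e2 : 1 / (M i : ℝ) - r + 2 * r = 1 / M i + r := by ring
    have e3 : 1 / (M i : ℝ) - r - r = 1 / M i - 2 * r := by ring
    refine ⟨1 / M i - r, r, hr0, ?_⟩
    rw [e1, e2, e3, sub_add_cancel, Measure.restrict_eq_self _ hS, Measure.restrict_eq_self _
      ((Ico_subset_Ico (by linarith) (by linarith)).trans hS)]
    refine ⟨hS, bumpSum_Ico_eq_volume hh fun j => ?_, ?_⟩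
    -- Bumps with `j ≤ i` start at or to the right of `1 / M i`; those with `j > i` end before the
    -- test interval because `h i` and `h j` are small.
    · rcases le_or_gt j i with hji | hji
      · left
        refine one_div_le_one_div_of_le (hM0' j) ?_
        have : M j ≤ M i :=
          Nat.pow_le_pow_left (Nat.pow_le_pow_right (by omega) (by omega)) 4
        exact_mod_cast this
      · right
        have h4 : 4 * M i ≤ M j := by
          calc 4 * M i ≤ B ^ 4 * M i :=
                Nat.mul_le_mul_right _ ((by omega : 4 ≤ B).trans (Nat.le_self_pow (by norm_num) B))
            _ = (B ^ (i + 1 + 1)) ^ 4 := by simp only [M]; ring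
            _ ≤ M j := Nat.pow_le_pow_left (Nat.pow_le_pow_right (by omega) (by omega)) 4
        have h5 : 1 / (M j : ℝ) ≤ 1 / M i / 4 := by
          rw [div_div, mul_comm]
          exact one_div_le_one_div_of_le (by linarith [hM0' i]) (by exact_mod_cast h4)
        linarith [hlt' i, hlt' j]
    · rw [← ENNReal.ofReal_coe_nnreal]
      exact lt_bumpSum_Ico (M := fun i => (M i : ℝ)) C.2 (by linarith) hMN (hh i) hCN

/-! ### Infinitely many probability measures. -/

theorem theorem1p2 (P : Finset ℕ) (hP : ∀ p ∈ P, p.Prime) :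
    {μ : Measure ℝ | IsProbabilityMeasure μ ∧ μ (Ico (0 : ℝ) 1)ᶜ = 0 ∧
      (∀ p ∈ P, IsAdicDoublingOn (Ico 0 1) p μ) ∧
      ¬ IsDoublingOn (Ico 0 1) μ}.Infinite := by
  obtain ⟨μ, hfin, hsupp, hle, hadic, hnd⟩ := exists_adic_doubling_bumps P hP
  set l : Measure ℝ := volume.restrict (Ico (0 : ℝ) 1) with hl
  have hl1 : l univ = 1 := by simp [hl]
  have hlS : l (Ico (0 : ℝ) 1)ᶜ = 0 := by
    rw [hl, Measure.restrict_apply measurableSet_Ico.compl, compl_inter_self, measure_empty]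
  have hZ1 : 1 ≤ μ univ := hl1 ▸ hle univ
  have hZ0 : μ univ ≠ 0 := (zero_lt_one.trans_le hZ1).ne'
  have hZt : μ univ ≠ ⊤ := measure_ne_top _ _
  let τ : ℝ → Measure ℝ := fun t =>
    (ENNReal.ofReal t * (μ univ)⁻¹) • μ + ENNReal.ofReal (1 - t) • l
  have hτ : ∀ t s, τ t s = ENNReal.ofReal t * (μ univ)⁻¹ * μ s + ENNReal.ofReal (1 - t) * l s :=
    fun t s => by simp [τ]
  have hmaps : MapsTo τ (Ioo 0 1) {μ : Measure ℝ | IsProbabilityMeasure μ ∧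
      μ (Ico (0 : ℝ) 1)ᶜ = 0 ∧ (∀ p ∈ P, IsAdicDoublingOn (Ico 0 1) p μ) ∧
      ¬ IsDoublingOn (Ico 0 1) μ} := by
    rintro t ⟨ht0, ht1⟩
    have hprob : IsProbabilityMeasure (τ t) := ⟨by
      rw [hτ, mul_assoc, ENNReal.inv_mul_cancel hZ0 hZt, hl1, mul_one, mul_one,
        ← ENNReal.ofReal_add ht0.le (by linarith), add_sub_cancel, ENNReal.ofReal_one]⟩
    set a : ℝ≥0∞ := ENNReal.ofReal t * (μ univ)⁻¹ with ha
    have ha0 : a ≠ 0 :=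
      mul_ne_zero (ENNReal.ofReal_pos.2 ht0).ne' (ENNReal.inv_ne_zero.2 hZt)
    have hat : a ≠ ⊤ := ENNReal.mul_ne_top ENNReal.ofReal_ne_top (ENNReal.inv_ne_top.2 hZ0)
    refine ⟨hprob, by rw [hτ, hsupp, hlS]; simp, fun p hp => ?_, ?_⟩
    · have hp0 := (hP p hp).pos
      have hpr : (1 : ℝ) ≤ p := by exact_mod_cast hp0
      have hlc : ∀ m k : ℤ, adicInterval p m k ⊆ Ico 0 1 → ∀ j ∈ Finset.Icc 1 p,
          l (adicChild p m k j) = ENNReal.ofReal (((p : ℝ) ^ (m + 1))⁻¹) := by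
        intro m k hS j hj
        rw [hl, Measure.restrict_eq_self _ ((adicChild_subset hp0 m k hj).trans hS),
          volume_adicChild]
      refine isAdicDoublingOn_of_le (C := (32 * (p : ℝ) ^ 2).toNNReal)
        (Real.toNNReal_pos.2 (by positivity)) (fun m k hS i hi j hj => ?_) fun m k hS j hj => ?_
      · rw [hτ, hτ, mul_add, mul_left_comm _ a, hlc m k hS i hi, hlc m k hS j hj]
        refine add_le_add (mul_le_mul_right (hadic p hp m k hS i hi j hj) _)
          (le_mul_of_one_le_left zero_le (ENNReal.one_le_ofReal.2 ?_))
        nlinarith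
      · have : μ (adicChild p m k j) ≠ 0 := by
          refine (lt_of_lt_of_le ?_ (hle _)).ne'
          rw [hlc m k hS j hj, ENNReal.ofReal_pos]
          positivity
        rw [hτ]
        exact fun h => mul_ne_zero ha0 this (add_eq_zero.1 h).1
    · rintro ⟨C, -, hC⟩
      set b : ℝ≥0∞ := ENNReal.ofReal (1 - t) with hb
      have hD : (C : ℝ≥0∞) * (a + b) / a ≠ ⊤ := ENNReal.div_ne_top
        (ENNReal.mul_ne_top ENNReal.coe_ne_top (ENNReal.add_ne_top.2 ⟨hat, ENNReal.ofReal_ne_top⟩))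
        ha0
      -- On `I` the mixture is `(a + b)` times Lebesgue measure, while on `2I` it is at least `a •
      -- μ`; hence this constant.
      obtain ⟨c, r, hr, hS, hI, h2I⟩ := hnd ((C : ℝ≥0∞) * (a + b) / a).toNNReal
      rw [ENNReal.coe_toNNReal hD] at h2I
      refine absurd (hC c r hr hS) (not_le.2 ?_)
      have hlI : l (Ico (c - r) (c + r)) = volume (Ico (c - r) (c + r)) := by
        rw [hl, Measure.restrict_eq_self _
          ((Ico_subset_Ico (by linarith) (by linarith)).trans hS)]
      rw [hτ, hτ, hI, hlI, ← add_mul]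
      calc (C : ℝ≥0∞) * ((a + b) * volume (Ico (c - r) (c + r)))
          = a * (C * (a + b) / a * volume (Ico (c - r) (c + r))) := by
            rw [← mul_assoc a, ENNReal.mul_div_cancel ha0 hat, mul_assoc]
        _ < a * μ (Ico (c - 2 * r) (c + 2 * r)) := (ENNReal.mul_lt_mul_iff_right ha0 hat).2 h2I
        _ ≤ _ := le_self_add
  have hinj : InjOn τ (Ioo 0 1) := by
    intro t ht t' ht' heq
    -- The factor `2 * μ univ` yields a set where normalized `μ` exceeds `l`; there the mass of `τ
    -- t` is affine in `t` with nonzero slope.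
    obtain ⟨c, r, hr, hS, -, h2I⟩ := hnd (2 * (μ univ).toNNReal)
    set s : Set ℝ := Ico (c - 2 * r) (c + 2 * r) with hs
    have hls : l s = 2 * volume (Ico (c - r) (c + r)) := by
      rw [hl, Measure.restrict_eq_self _ hS, hs, Real.volume_Ico, Real.volume_Ico,
        show (2 : ℝ≥0∞) = ENNReal.ofReal 2 by norm_num, ← ENNReal.ofReal_mul two_pos.le]
      ring_nf
    have hlt : l s < (μ univ)⁻¹ * μ s := by
      rw [← ENNReal.div_eq_inv_mul, ENNReal.lt_div_iff_mul_lt (Or.inl hZ0) (Or.inl hZt), hls]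
      rw [ENNReal.coe_mul, ENNReal.coe_toNNReal hZt] at h2I
      calc _ = _ := by
            push_cast
            ring
        _ < μ s := h2I
    have hm : (μ univ)⁻¹ * μ s ≠ ⊤ :=
      ENNReal.mul_ne_top (ENNReal.inv_ne_top.2 hZ0) (measure_ne_top _ _)
    have hlr := (ENNReal.toReal_lt_toReal hlt.ne_top hm).2 hlt
    have hreal : ∀ t ∈ Ioo (0 : ℝ) 1, (τ t s).toReal =
        t * ((μ univ)⁻¹ * μ s).toReal + (1 - t) * (l s).toReal := by
      rintro t ⟨h0, h1⟩
      rw [hτ, mul_assoc, ENNReal.toReal_add (ENNReal.mul_ne_top ENNReal.ofReal_ne_top hm)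
        (ENNReal.mul_ne_top ENNReal.ofReal_ne_top hlt.ne_top),
        ENNReal.toReal_mul (a := ENNReal.ofReal t), ENNReal.toReal_mul (a := ENNReal.ofReal (1 - t)),
        ENNReal.toReal_ofReal h0.le, ENNReal.toReal_ofReal (by linarith)]
    have h1 := hreal t ht
    rw [heq, hreal t' ht'] at h1
    have h2 : (t' - t) * (((μ univ)⁻¹ * μ s).toReal - (l s).toReal) = 0 := by linarith
    rcases mul_eq_zero.1 h2 with h3 | h3 <;> linarith
  exact infinite_of_injOn_mapsTo hinj hmaps (Ioo_infinite one_pos)
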